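/- Let $I=[0,1]$ and let $\mathbf{Tych}$ be the category of Tychonoff spaces and continuous maps. For a Tychonoff space $X$ let $\beta X\supseteq X$ be its Stone–Čech compactification and let $\exp X$ be the set of nonempty closed subsets of $X$. *The monad $\check{\mathbb G}$.* A compact inclusion hyperspace on $X$ is a nonempty family $\mathcal F\subseteq\exp X$ such that $A\in\mathcal F$, $A\subseteq B\in\exp X$ imply $B\in\mathcal F$, and such that $\mathcal F$ is compact in the lower topology on $\exp X$ (the one with subbase $\{F: F\cap U\neq\emptyset\}$, $U$ open in $X$). Let $\check GX$ be the set of all of them. For a compact Hausdorff space $K$ let $GK$ be the set of all nonempty upward closed families in $\exp K$ that are closed in the Vietoris topology, with the topology whose subbase consists of the sets $U^+=\{\mathcal F:\exists F\in\mathcal F,\ F\subseteq U\}$ and $U^-=\{\mathcal F:\forall F\in\mathcal F,\ F\cap U\ne\emptyset\}$, $U$ open in $K$. The topology of $\check GX$ is the one induced by the injection $\check GX\to G\beta X$, $\mathcal F\mapsto\{G\in\exp\beta X: G\cap X\in\mathcal F\}$. With $$\check Gf(\mathcal F)=\{B\in\exp Y: B\supseteq f(A)\text{ for some }A\in\mathcal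 F\}\quad(f:X\to Y),$$ $$\check\eta_GX(x)=\{F\in\exp X: x\in F\},\qquad \check\mu_GX(\Phi)=\{F\in\exp X: F\in\textstyle\bigcap H\text{ for some }H\in\Phi\},$$ $\check{\mathbb G}=(\check G,\check\eta_G,\check\mu_G)$ is a monad on $\mathbf{Tych}$. *The monad $\check{\mathbb M}$.* A $\tau$-smooth capacity on $X$ is a monotone function $c:\exp X\cup\{\emptyset\}\to I$ with $c(\emptyset)=0$, $c(X)=1$ and $\inf_\alpha c(F_\alpha)\le c(G)$ whenever $(F_\alpha)$ is a decreasing net of closed sets, $G$ is closed and $\bigcap_\alpha F_\alpha\subseteq G$. Let $\check MX$ be the set of all of them. For a compact Hausdorff space $K$ let $MK$ be the set of all monotone $c:\exp K\cup\{\emptyset\}\to I$ with $c(\emptyset)=0$, $c(K)=1$ such that $c(F)<a$ implies that there is an open $U\supseteq F$ with $c(G)<a$ for all closed $G\subseteq U$; its topology has the subbase of all sets $\{c: c(F)<a\}$ ($F$ closed, $a\in\mathbb R$) and $\{c: c(F)>a\text{ for some closed }F\subseteq U\}$ ($U$ open, $a\in\mathbb R$). The topology of $\check MX$ is the one induced by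 the injection $\check MX\to M\beta X$, $c\mapsto(F\mapsto c(F\cap X))$. With $$\check Mf(c)(F)=c(f^{-1}(F)),\qquad \check\eta_MX(x)(F)=\begin{cases}1,&x\in F,\\0,&x\notin F,\end{cases}\qquad \check\mu_MX(C)(F)=\sup_{\alpha\in I}\ \min\bigl(\alpha,\,C(\{c\in\check MX: c(F)\ge\alpha\})\bigr),$$ $\check{\mathbb M}=(\check M,\check\eta_M,\check\mu_M)$ is a monad on $\mathbf{Tych}$. **Statement.** For every Tychonoff space $X$ and every $\mathcal F\in\check GX$ let $i_G^MX(\mathcal F):\exp X\cup\{\emptyset\}\to I$ be the function with value $1$ at each closed $A\in\mathcal F$ and $0$ at each closed $A\notin\mathcal F$. Then $i_G^MX(\mathcal F)\in\check MX$, the map $i_G^MX:\check GX\to\check MX$ is a topological embedding, and the collection $i_G^M=(i_G^MX)_X$ is a morphism of monads $\check{\mathbb G}\to\check{\mathbb M}$. Consequently $\check{\mathbb G}$ is a submonad of $\check{\mathbb M}$, i.e. there is a morphism of monads $\check{\mathbb G}\to\check{\mathbb M}$ all of whose components are embeddings. -/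

import Mathlib

open CategoryTheory TopologicalSpace Topology Set

universe u

noncomputable section

namespace TychMonad

/-- The set `exp X` of all nonempty closed subsets of `X`. -/
abbrev Exp (X : Type u) [TopologicalSpace X] : Type u :=
  {F : Closeds X // (F : Set X).Nonempty}

/-- The lower topology on `exp X`, with subbase the sets `{F | F ∩ U ≠ ∅}`, `U` open in `X`. -/
@[reducible]
def lowerTopology (X : Type u) [TopologicalSpace X] : TopologicalSpace (Exp X) :=
  generateFrom {S | ∃ U : Set X, IsOpen U ∧ S = {F : Exp X | ((F.1 : Set X) ∩ U).Nonempty}}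

/-- The Vietoris topology on `exp X`. -/
@[reducible]
def vietorisTopology (X : Type u) [TopologicalSpace X] : TopologicalSpace (Exp X) :=
  (TopologicalSpace.vietoris X).induced (fun F => (F.1 : Set X))

/-! ### Closed sets in the Stone-Čech compactification -/

/-- The traces on `X` of the closed neighbourhoods of a closed set in `βX`. -/
def nhdsTraces {X : Type u} [TopologicalSpace X] (A : Closeds (StoneCech X)) : Set (Closeds X) :=
  {N | ∃ W : Closeds (StoneCech X), (W : Set (StoneCech X)) ∈ 𝓝ˢ (A : Set (StoneCech X)) ∧
    N = W.preimage continuous_stoneCechUnit}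

theorem nhdsTraces_nonempty {X : Type u} [TopologicalSpace X] (A : Closeds (StoneCech X)) :
    (nhdsTraces A).Nonempty :=
  ⟨_, ⊤, Filter.univ_mem, rfl⟩

theorem nhdsTraces_directedOn {X : Type u} [TopologicalSpace X] (A : Closeds (StoneCech X)) :
    DirectedOn (· ≥ ·) (nhdsTraces A) := by
  rintro _ ⟨V, hV, rfl⟩ _ ⟨W, hW, rfl⟩
  exact ⟨_, ⟨V ⊓ W, Filter.inter_mem hV hW, rfl⟩, fun _ hx => hx.1, fun _ hx => hx.2⟩

theorem sInf_nhdsTraces_le {X : Type u} [TopologicalSpace X] (A : Closeds (StoneCech X)) :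
    sInf (nhdsTraces A) ≤ A.preimage continuous_stoneCechUnit := by
  intro x hx
  by_contra hxA
  obtain ⟨u, hu, hAu, hux⟩ := normal_exists_closure_subset A.isClosed
    (isOpen_compl_singleton (x := stoneCechUnit x))
    (by rintro y hy rfl; exact hxA hy)
  have := Closeds.mem_sInf.1 hx _ ⟨⟨closure u, isClosed_closure⟩,
    Filter.mem_of_superset (hu.mem_nhdsSet.2 hAu) subset_closure, rfl⟩
  exact hux this rfl

theorem preimage_closure_image {X : Type u} [TopologicalSpace X] [T35Space X] (A : Closeds X) :
    (Closeds.closure (stoneCechUnit '' (A : Set X))).preimage continuous_stoneCechUnit = A := by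
  apply SetLike.coe_injective
  change stoneCechUnit ⁻¹' closure (stoneCechUnit '' (A : Set X)) = A
  rw [← isEmbedding_stoneCechUnit.isInducing.closure_eq_preimage_closure_image,
    A.isClosed.closure_eq]

/-- The closed set `{x | φ x ≥ α}`. -/
def superlevel {X : Type u} [TopologicalSpace X] (φ : C(X, unitInterval)) (α : unitInterval) :
    Closeds X :=
  ⟨{x | α ≤ φ x}, isClosed_le continuous_const φ.continuous⟩

theorem superlevel_anti {X : Type u} [TopologicalSpace X] (φ : C(X, unitInterval))
    {α β : unitInterval} (h : α ≤ β) : superlevel φ β ≤ superlevel φ α :=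
  fun _ hx => h.trans hx

theorem mem_superlevel_of_lt {X : Type u} [TopologicalSpace X] (φ : C(X, unitInterval))
    {α : unitInterval} (x : X) (h : ∀ b < α, x ∈ superlevel φ b) : x ∈ superlevel φ α := by
  change α ≤ φ x
  refine le_of_forall_lt fun b hb => ?_
  obtain ⟨d, hbd, hd⟩ := exists_between hb
  exact hbd.trans_le (h d hd)

/-- The continuous extension of `φ : X → I` to `βX`. -/
def stoneExt {X : Type u} [TopologicalSpace X] (φ : C(X, unitInterval)) :
    C(StoneCech X, unitInterval) :=
  ⟨stoneCechExtend φ.continuous, continuous_stoneCechExtend _⟩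

theorem superlevel_stoneExt {X : Type u} [TopologicalSpace X] (φ : C(X, unitInterval))
    (α : unitInterval) :
    (superlevel (stoneExt φ) α).preimage continuous_stoneCechUnit = superlevel φ α := by
  ext x
  change α ≤ stoneCechExtend φ.continuous (stoneCechUnit x) ↔ α ≤ φ x
  rw [stoneCechExtend_stoneCechUnit]

/-- Urysohn functions with values in the unit interval. -/
theorem exists_urysohn {K : Type u} [TopologicalSpace K] [NormalSpace K] {F U : Set K}
    (hF : IsClosed F) (hU : IsOpen U) (h : F ⊆ U) :
    ∃ φ : C(K, unitInterval), (∀ x ∈ F, φ x = 1) ∧ ∀ x, 0 < φ x → x ∈ U := by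
  obtain ⟨f, hf0, hf1, hf⟩ := exists_continuous_zero_one_of_isClosed hU.isClosed_compl hF
    (disjoint_compl_left_iff_subset.2 h)
  refine ⟨⟨fun x => ⟨f x, hf x⟩, by fun_prop⟩, fun x hx => Subtype.ext (hf1 hx), fun x hx => ?_⟩
  by_contra hxU
  have h0 : f x = 0 := hf0 hxU
  have : (0 : ℝ) < f x := hx
  linarith

/-! ### Inclusion hyperspaces -/

/-- Inclusion hyperspaces on a compactum `K`: nonempty Vietoris-closed families of nonempty closed
sets that are closed under passing to larger closed sets. -/
structure InclusionHyperspace (K : Type u) [TopologicalSpace K] where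
  sets : Set (Exp K)
  sets_nonempty : sets.Nonempty
  upward : ∀ A B : Exp K, A.1 ≤ B.1 → A ∈ sets → B ∈ sets
  closed : @IsClosed (Exp K) (vietorisTopology K) sets

/-- The topology on the set `GK` of inclusion hyperspaces of a compactum `K`, with the subbase of
all sets `U⁺` and `U⁻`, `U` open in `K`. -/
instance (K : Type u) [TopologicalSpace K] : TopologicalSpace (InclusionHyperspace K) :=
  generateFrom
    ({S | ∃ U : Set K, IsOpen U ∧
        S = {𝓕 : InclusionHyperspace K | ∃ F ∈ 𝓕.sets, (F.1 : Set K) ⊆ U}} ∪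
      {S | ∃ U : Set K, IsOpen U ∧
        S = {𝓕 : InclusionHyperspace K | ∀ F ∈ 𝓕.sets, ((F.1 : Set K) ∩ U).Nonempty}})

namespace InclusionHyperspace

variable {K : Type u} [TopologicalSpace K]

/-- The number `max {α | {φ ≥ α} ∈ 𝓕}`. -/
def val (𝓕 : InclusionHyperspace K) (φ : C(K, unitInterval)) : unitInterval :=
  sSup {α | ∃ h : (superlevel φ α : Set K).Nonempty, (⟨superlevel φ α, h⟩ : Exp K) ∈ 𝓕.sets}

theorem lt_val_iff (𝓕 : InclusionHyperspace K) (φ : C(K, unitInterval)) (a : unitInterval) :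
    a < 𝓕.val φ ↔ ∃ α > a, ∃ h : (superlevel φ α : Set K).Nonempty,
      (⟨superlevel φ α, h⟩ : Exp K) ∈ 𝓕.sets := by
  rw [val, lt_sSup_iff]
  exact ⟨fun ⟨α, h, h'⟩ => ⟨α, h', h⟩, fun ⟨α, h, h'⟩ => ⟨α, h', h⟩⟩

theorem isOpen_plus {U : Set K} (hU : IsOpen U) :
    IsOpen {𝓕 : InclusionHyperspace K | ∃ F ∈ 𝓕.sets, (F.1 : Set K) ⊆ U} :=
  isOpen_generateFrom_of_mem (.inl ⟨U, hU, rfl⟩)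

theorem isOpen_minus {U : Set K} (hU : IsOpen U) :
    IsOpen {𝓕 : InclusionHyperspace K | ∀ F ∈ 𝓕.sets, ((F.1 : Set K) ∩ U).Nonempty} :=
  isOpen_generateFrom_of_mem (.inr ⟨U, hU, rfl⟩)

theorem exists_nhd (𝓕 : InclusionHyperspace K) [CompactSpace K] [T2Space K] (A : Closeds K)
    (hA : ∀ h : (A : Set K).Nonempty, (⟨A, h⟩ : Exp K) ∉ 𝓕.sets) :
    ∃ V : Set K, IsOpen V ∧ (A : Set K) ⊆ V ∧ ∀ F ∈ 𝓕.sets, ¬ (F.1 : Set K) ⊆ V := by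
  by_contra hcon
  push Not at hcon
  have hne : (A : Set K).Nonempty := by
    by_contra hA'
    obtain ⟨F, hF, hF'⟩ := hcon ∅ isOpen_empty (not_nonempty_iff_eq_empty.1 hA').le
    obtain ⟨x, hx⟩ := F.2
    exact hF' hx
  refine hA hne ?_
  let _ := TopologicalSpace.vietoris K
  let _ := vietorisTopology K
  -- otherwise the basic neighbourhoods of `A` contain members of `𝓕`
  have hcl : IsClosed 𝓕.sets := 𝓕.closed
  rw [← hcl.closure_eq]
  have hind : IsInducing (fun F : Exp K => (F.1 : Set K)) := ⟨rfl⟩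
  rw [hind.closure_eq_preimage_closure_image, mem_preimage,
    TopologicalSpace.vietoris.isTopologicalBasis.mem_closure_iff]
  rintro _ ⟨u, ⟨hu, huo⟩, rfl⟩ ⟨hAu, hAu'⟩
  obtain ⟨F, hF, hFu⟩ := hcon (⋃₀ u) (isOpen_sUnion huo) hAu
  let B : Exp K := ⟨F.1 ⊔ A, hne.mono fun x hx => Or.inr hx⟩
  refine ⟨B.1, ⟨union_subset hFu hAu, fun U hU => ?_⟩, B, 𝓕.upward F B le_sup_left hF, rfl⟩
  obtain ⟨x, hx, hxU⟩ := hAu' U hU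
  exact ⟨x, Or.inr hx, hxU⟩

/-- On a compactum, the topology of `GK` is the weak topology of the maps `𝓕 ↦ val 𝓕 φ`. -/
theorem isInducing_val [CompactSpace K] [T2Space K] :
    IsInducing (fun (𝓕 : InclusionHyperspace K) (φ : C(K, unitInterval)) => 𝓕.val φ) := by
  have hcont : Continuous
      (fun (𝓕 : InclusionHyperspace K) (φ : C(K, unitInterval)) => 𝓕.val φ) := by
    refine continuous_pi fun φ => ?_
    rw [OrderTopology.continuous_iff]
    intro a
    constructor
    · convert isOpen_plus (isOpen_lt continuous_const φ.continuous : IsOpen {x | a < φ x}) using 1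
      ext 𝓕
      simp only [mem_preimage, mem_Ioi, lt_val_iff, mem_ofPred_eq]
      constructor
      · rintro ⟨α, hα, h, hF⟩
        exact ⟨_, hF, fun x hx => lt_of_lt_of_le hα hx⟩
      · rintro ⟨F, hF, hFa⟩
        obtain ⟨x, hx, hmin⟩ := F.1.isClosed.isCompact.exists_isMinOn F.2 φ.continuous.continuousOn
        have hle : F.1 ≤ superlevel φ (φ x) := fun y hy => hmin hy
        exact ⟨φ x, hFa hx, F.2.mono hle, 𝓕.upward _ _ hle hF⟩
    · convert isOpen_minus (isOpen_lt φ.continuous continuous_const : IsOpen {x | φ x < a}) using 1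
      ext 𝓕
      simp only [mem_preimage, mem_Iio, mem_ofPred_eq]
      constructor
      · intro h F hF
        by_contra hcon
        have hle : F.1 ≤ superlevel φ a := fun y hy => by
          by_contra hya
          exact hcon ⟨y, hy, (not_le.1 hya : φ y < a)⟩
        exact absurd h (not_lt.2 (le_sSup ⟨F.2.mono hle, 𝓕.upward _ _ hle hF⟩))
      · intro h
        obtain ⟨V, hV, hVa, hVF⟩ := 𝓕.exists_nhd (superlevel φ a) (fun hn hF => by
          obtain ⟨x, hx, hxa⟩ := h _ hF
          exact (not_lt.2 hx : ¬ φ x < a) hxa)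
        have hnb : ∃ b < a, ∀ x, b ≤ φ x → x ∈ V := by
          rcases (Vᶜ : Set K).eq_empty_or_nonempty with hem | hne
          · obtain ⟨F, hF⟩ := 𝓕.sets_nonempty
            exact absurd (compl_empty_iff.1 hem ▸ subset_univ _) (hVF F hF)
          · obtain ⟨x, hx, hmax⟩ :=
              hV.isClosed_compl.isCompact.exists_isMaxOn hne φ.continuous.continuousOn
            have hxa : φ x < a := by
              by_contra hxa
              exact hx (hVa (not_lt.1 hxa))
            obtain ⟨b, hb, hba⟩ := exists_between hxa
            refine ⟨b, hba, fun y hy => ?_⟩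
            by_contra hyV
            exact absurd (hmax hyV) (not_le.2 (hb.trans_le hy))
        obtain ⟨b, hba, hb⟩ := hnb
        refine lt_of_le_of_lt (sSup_le ?_) hba
        rintro α ⟨hn, hα⟩
        by_contra hαb
        exact hVF _ hα fun x hx => hb x ((not_le.1 hαb).le.trans hx)
  refine ⟨le_antisymm hcont.le_induced (le_generateFrom ?_)⟩
  rintro _ (⟨U, hU, rfl⟩ | ⟨U, hU, rfl⟩)
  · rw [@isOpen_iff_forall_mem_open]
    rintro 𝓕 ⟨F, hF, hFU⟩
    obtain ⟨φ, hφ1, hφ0⟩ := exists_urysohn F.1.isClosed hU hFU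
    refine ⟨_, ?_, @IsOpen.preimage _ _ (_) _ _ continuous_induced_dom _
      ((continuous_apply φ).isOpen_preimage _ (isOpen_Ioi (a := (0 : unitInterval)))), ?_⟩
    · intro 𝓖 h𝓖
      obtain ⟨α, hα, hn, h⟩ := (lt_val_iff 𝓖 φ 0).1 h𝓖
      exact ⟨_, h, fun x hx => hφ0 x (lt_of_lt_of_le hα hx)⟩
    · refine (lt_val_iff 𝓕 φ 0).2 ⟨1, zero_lt_one, ?_⟩
      have hle : F.1 ≤ superlevel φ 1 := fun x hx => (hφ1 x hx).ge
      exact ⟨F.2.mono hle, 𝓕.upward _ _ hle hF⟩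
  · rw [@isOpen_iff_forall_mem_open]
    intro 𝓕 h𝓕
    obtain ⟨V, hV, hUV, hVF⟩ := 𝓕.exists_nhd ⟨Uᶜ, hU.isClosed_compl⟩ (fun hn hF => by
      obtain ⟨x, hx, hxU⟩ := h𝓕 _ hF
      exact hx hxU)
    obtain ⟨φ, hφ1, hφ0⟩ := exists_urysohn hU.isClosed_compl hV hUV
    refine ⟨_, ?_, @IsOpen.preimage _ _ (_) _ _ continuous_induced_dom _
      ((continuous_apply φ).isOpen_preimage _ (isOpen_Iio (a := (1 : unitInterval)))), ?_⟩
    · intro 𝓖 h𝓖 F hF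
      by_contra hcon
      have hle : F.1 ≤ superlevel φ 1 := fun x hx => (hφ1 x fun hxU => hcon ⟨x, hx, hxU⟩).ge
      have hlt : 𝓖.val φ < 1 := h𝓖
      exact absurd hlt (not_lt.2 (le_sSup ⟨F.2.mono hle, 𝓖.upward _ _ hle hF⟩))
    · refine lt_of_le_of_lt (sSup_le ?_) (zero_lt_one (α := unitInterval))
      rintro α ⟨hn, hα⟩
      by_contra hα0
      exact hVF _ hα fun x hx => hφ0 x ((not_le.1 hα0).trans_le hx)

instance [CompactSpace K] [T2Space K] : T35Space (InclusionHyperspace K) :=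
  have : T0Space (InclusionHyperspace K) := by
    refine ⟨fun 𝓕 𝓖 h => ?_⟩
    have key : ∀ 𝓕 𝓖 : InclusionHyperspace K, Inseparable 𝓕 𝓖 → 𝓕.sets ⊆ 𝓖.sets := by
      intro 𝓕 𝓖 h A hA
      by_contra hA'
      obtain ⟨x, hx, hx'⟩ := (h.mem_open_iff (isOpen_minus A.1.isClosed.isOpen_compl)).2
        (fun F hF => by
          by_contra hcon
          refine hA' (𝓖.upward F A (fun x hx => ?_) hF)
          by_contra hxA
          exact hcon ⟨x, hx, hxA⟩) A hA
      exact hx' hx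
    have hs : 𝓕.sets = 𝓖.sets := (key 𝓕 𝓖 h).antisymm (key 𝓖 𝓕 h.symm)
    cases 𝓕
    cases 𝓖
    cases hs
    rfl
  { toT0Space := this, toCompletelyRegularSpace := isInducing_val.completelyRegularSpace }

end InclusionHyperspace

/-- Compact inclusion hyperspaces in a Tychonoff space `X`: the elements of `ǦX`. -/
structure CompactInclusionHyperspace (X : Type u) [TopologicalSpace X] where
  sets : Set (Exp X)
  sets_nonempty : sets.Nonempty
  upward : ∀ A B : Exp X, A.1 ≤ B.1 → A ∈ sets → B ∈ sets
  compact : @IsCompact (Exp X) (lowerTopology X) sets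

/-- `A ∈ 𝓕` for a closed set `A` that is not known to be nonempty. -/
instance (X : Type u) [TopologicalSpace X] :
    Membership (Closeds X) (CompactInclusionHyperspace X) :=
  ⟨fun 𝓕 A => ∃ h : (A : Set X).Nonempty, (⟨A, h⟩ : Exp X) ∈ 𝓕.sets⟩

namespace CompactInclusionHyperspace

variable {X Y : Type u} [TopologicalSpace X] [TopologicalSpace Y]

theorem mem_mono (𝓕 : CompactInclusionHyperspace X) {A B : Closeds X} (hA : A ∈ 𝓕) (h : A ≤ B) :
    B ∈ 𝓕 := by
  obtain ⟨hn, hA⟩ := hA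
  exact ⟨hn.mono h, 𝓕.upward _ _ h hA⟩

theorem mem_iff (𝓕 : CompactInclusionHyperspace X) (A : Exp X) : A.1 ∈ 𝓕 ↔ A ∈ 𝓕.sets :=
  ⟨fun ⟨_, h⟩ => h, fun h => ⟨A.2, h⟩⟩

theorem ext_mem {𝓕 𝓖 : CompactInclusionHyperspace X} (h : ∀ A : Closeds X, A ∈ 𝓕 ↔ A ∈ 𝓖) :
    𝓕 = 𝓖 := by
  have hs : 𝓕.sets = 𝓖.sets := by
    ext A
    rw [← mem_iff, ← mem_iff, h]
  cases 𝓕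
  cases 𝓖
  cases hs
  rfl

theorem top_mem (𝓕 : CompactInclusionHyperspace X) : (⊤ : Closeds X) ∈ 𝓕 := by
  obtain ⟨A, hA⟩ := 𝓕.sets_nonempty
  exact 𝓕.mem_mono ((𝓕.mem_iff A).2 hA) le_top

/-- A compact inclusion hyperspace is closed under intersections of filtered families. -/
theorem sInf_mem (𝓕 : CompactInclusionHyperspace X) (D : Set (Closeds X)) (hne : D.Nonempty)
    (hdir : DirectedOn (· ≥ ·) D) (hD : ∀ A ∈ D, A ∈ 𝓕) : sInf D ∈ 𝓕 := by
  by_contra hcon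
  let _ := lowerTopology X
  have : Nonempty D := hne.to_subtype
  obtain ⟨⟨A, hAD⟩, hA⟩ := 𝓕.compact.elim_directed_cover
    (fun A : D => {F : Exp X | ((F.1 : Set X) ∩ (A.1 : Set X)ᶜ).Nonempty})
    (fun A => isOpen_generateFrom_of_mem ⟨_, A.1.isClosed.isOpen_compl, rfl⟩)
    (by
      intro F hF
      by_contra hF'
      simp only [mem_iUnion, not_exists] at hF'
      refine hcon (𝓕.mem_mono ((𝓕.mem_iff F).2 hF) (le_sInf fun A hA x hx => ?_))
      by_contra hxA
      exact hF' ⟨A, hA⟩ ⟨x, hx, hxA⟩)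
    (by
      rintro ⟨A, hA⟩ ⟨B, hB⟩
      obtain ⟨C, hC, hAC, hBC⟩ := hdir A hA B hB
      refine ⟨⟨C, hC⟩, ?_, ?_⟩
      · rintro F ⟨x, hx, hxA⟩
        exact ⟨x, hx, fun h => hxA (hAC h)⟩
      · rintro F ⟨x, hx, hxA⟩
        exact ⟨x, hx, fun h => hxA (hBC h)⟩)
  obtain ⟨hn, hA'⟩ := hD A hAD
  obtain ⟨x, hx, hx'⟩ := hA hA'
  exact hx' hx

/-- An upward closed family that is closed under intersections of filtered families is compact in
the lower topology. -/
theorem isCompact_of_sInf (s : Set (Exp X)) (up : ∀ A B : Exp X, A.1 ≤ B.1 → A ∈ s → B ∈ s)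
    (h : ∀ D : Set (Closeds X), D.Nonempty → DirectedOn (· ≥ ·) D →
      (∀ A ∈ D, ∃ hA : (A : Set X).Nonempty, (⟨A, hA⟩ : Exp X) ∈ s) →
      ∃ hA : ((sInf D : Closeds X) : Set X).Nonempty, (⟨sInf D, hA⟩ : Exp X) ∈ s) :
    @IsCompact (Exp X) (lowerTopology X) s := by
  let _ := lowerTopology X
  refine isCompact_generateFrom rfl fun P hP hs => ?_
  by_contra hcon
  push Not at hcon
  have hP' : ∀ V ∈ P, ∃ U : Set X, IsOpen U ∧ V = {F : Exp X | ((F.1 : Set X) ∩ U).Nonempty} :=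
    fun V hV => hP hV
  choose! U hU hPU using hP'
  -- the filtered family of complements of finite unions
  let C : {Q : Set (Set (Exp X)) // Q ⊆ P ∧ Q.Finite} → Closeds X := fun Q =>
    ⟨⋂ V ∈ Q.1, (U V)ᶜ, isClosed_biInter fun V hV => (hU V (Q.2.1 hV)).isClosed_compl⟩
  have hmem : ∀ Q, ∃ hA : ((C Q : Closeds X) : Set X).Nonempty, (⟨C Q, hA⟩ : Exp X) ∈ s := by
    rintro ⟨Q, hQP, hQf⟩
    obtain ⟨F, hF, hFQ⟩ := not_subset.1 (hcon Q hQP hQf)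
    have hsub : F.1 ≤ C ⟨Q, hQP, hQf⟩ := by
      intro x hx
      change x ∈ ⋂ V ∈ Q, (U V)ᶜ
      simp only [mem_iInter]
      intro V hV hxV
      refine hFQ ⟨V, hV, ?_⟩
      rw [hPU V (hQP hV)]
      exact ⟨x, hx, hxV⟩
    exact ⟨F.2.mono hsub, up F _ hsub hF⟩
  obtain ⟨hne, hB⟩ := h (range C) ⟨_, ⟨⟨∅, empty_subset _, finite_empty⟩, rfl⟩⟩
    (by
      rintro _ ⟨Q, rfl⟩ _ ⟨R, rfl⟩
      refine ⟨_, ⟨⟨Q.1 ∪ R.1, union_subset Q.2.1 R.2.1, Q.2.2.union R.2.2⟩, rfl⟩, ?_, ?_⟩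
      · exact biInter_subset_biInter_left subset_union_left
      · exact biInter_subset_biInter_left subset_union_right)
    (by rintro _ ⟨Q, rfl⟩; exact hmem Q)
  obtain ⟨V, hV, hBV⟩ := hs hB
  rw [hPU V hV] at hBV
  obtain ⟨x, hx, hxV⟩ := hBV
  have hx' : x ∈ C ⟨{V}, by simpa using hV, finite_singleton V⟩ :=
    Closeds.mem_sInf.1 hx _ ⟨_, rfl⟩
  change x ∈ ⋂ W ∈ ({V} : Set _), (U W)ᶜ at hx'
  simp only [mem_singleton_iff, iInter_iInter_eq_left] at hx'
  exact hx' hxV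

/-- The embedding `e_G X : ǦX → GβX`, `𝓕 ↦ {G | G ∩ X ∈ 𝓕}`. -/
def toStoneCech (𝓕 : CompactInclusionHyperspace X) : InclusionHyperspace (StoneCech X) where
  sets := {G | G.1.preimage continuous_stoneCechUnit ∈ 𝓕}
  sets_nonempty := ⟨⟨⊤, by
    obtain ⟨⟨x, -⟩, -⟩ := 𝓕.top_mem
    exact ⟨stoneCechUnit x, mem_univ _⟩⟩, 𝓕.top_mem⟩
  upward A B h hA := 𝓕.mem_mono hA fun _ hx => h hx
  closed := by
    let _ := TopologicalSpace.vietoris (StoneCech X)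
    let _ := vietorisTopology (StoneCech X)
    rw [← isOpen_compl_iff, isOpen_iff_forall_mem_open]
    intro A hA
    have key : ∃ N ∈ nhdsTraces A.1, N ∉ 𝓕 := by
      by_contra hcon
      push Not at hcon
      exact hA (𝓕.mem_mono (𝓕.sInf_mem _ (nhdsTraces_nonempty _) (nhdsTraces_directedOn _) hcon)
        (sInf_nhdsTraces_le _))
    obtain ⟨_, ⟨W, hW, rfl⟩, hN⟩ := key
    refine ⟨{B | (B.1 : Set _) ⊆ interior (W : Set (StoneCech X))}, ?_, ?_, ?_⟩
    · intro B hB hB'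
      refine hN (𝓕.mem_mono hB' fun x hx => ?_)
      exact interior_subset (s := (W : Set (StoneCech X))) (hB hx)
    · exact isOpen_induced (f := fun F : Exp (StoneCech X) => (F.1 : Set (StoneCech X)))
        (isOpen_interior (s := (W : Set (StoneCech X)))).powerset_vietoris
    · exact subset_interior_iff_mem_nhdsSet.2 hW

/-- `ǦX` carries the topology which makes `e_G X` an embedding. -/
instance : TopologicalSpace (CompactInclusionHyperspace X) :=
  TopologicalSpace.induced toStoneCech inferInstance

theorem isInducing_toStoneCech :
    IsInducing (toStoneCech : CompactInclusionHyperspace X → InclusionHyperspace (StoneCech X)) :=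
  ⟨rfl⟩

theorem toStoneCech_injective [T35Space X] :
    Function.Injective
      (toStoneCech : CompactInclusionHyperspace X → InclusionHyperspace (StoneCech X)) := by
  intro 𝓕 𝓖 h
  refine ext_mem fun A => ?_
  have key : ∀ 𝓗 : CompactInclusionHyperspace X, A ∈ 𝓗 ↔
      ∃ hn, (⟨Closeds.closure (stoneCechUnit '' (A : Set X)), hn⟩ : Exp _) ∈
        𝓗.toStoneCech.sets := by
    intro 𝓗
    constructor
    · intro hA
      have hA' := hA
      rw [← preimage_closure_image A] at hA'
      exact ⟨(hA.1.image _).mono subset_closure, hA'⟩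
    · rintro ⟨hn, hA⟩
      rw [← preimage_closure_image A]
      exact hA
  rw [key, key, h]

instance [T35Space X] : T35Space (CompactInclusionHyperspace X) :=
  IsEmbedding.t35Space ⟨isInducing_toStoneCech, toStoneCech_injective⟩

/-- The number `max {α | {φ ≥ α} ∈ 𝓕}`. -/
def val (𝓕 : CompactInclusionHyperspace X) (φ : C(X, unitInterval)) : unitInterval :=
  sSup {α | superlevel φ α ∈ 𝓕}

theorem le_val_iff (𝓕 : CompactInclusionHyperspace X) (φ : C(X, unitInterval)) {α : unitInterval}
    (hα : 0 < α) : α ≤ 𝓕.val φ ↔ superlevel φ α ∈ 𝓕 := by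
  refine ⟨fun h => ?_, fun h => le_sSup h⟩
  refine 𝓕.mem_mono (𝓕.sInf_mem (superlevel φ '' Iio α) ⟨_, 0, hα, rfl⟩ ?_ ?_) ?_
  · rintro _ ⟨a, ha, rfl⟩ _ ⟨b, hb, rfl⟩
    exact ⟨_, ⟨a ⊔ b, (max_lt ha hb : a ⊔ b < α), rfl⟩, superlevel_anti φ le_sup_left,
      superlevel_anti φ le_sup_right⟩
  · rintro _ ⟨a, ha, rfl⟩
    obtain ⟨b, hb, hab⟩ := lt_sSup_iff.1 (lt_of_lt_of_le ha h)
    exact 𝓕.mem_mono hb (superlevel_anti φ hab.le)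
  · intro x hx
    exact mem_superlevel_of_lt φ x fun b hb => Closeds.mem_sInf.1 hx _ ⟨b, hb, rfl⟩

theorem val_toStoneCech (𝓕 : CompactInclusionHyperspace X) (ψ : C(StoneCech X, unitInterval)) :
    𝓕.toStoneCech.val ψ = 𝓕.val (ψ.comp ⟨stoneCechUnit, continuous_stoneCechUnit⟩) := by
  unfold InclusionHyperspace.val val
  congr 1
  ext α
  constructor
  · rintro ⟨hn, h⟩
    exact h
  · intro h
    have h' : (superlevel ψ α).preimage continuous_stoneCechUnit ∈ 𝓕 := h
    obtain ⟨x, hx⟩ := h'.1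
    exact ⟨⟨_, hx⟩, h'⟩

theorem continuous_val (φ : C(X, unitInterval)) :
    Continuous fun 𝓕 : CompactInclusionHyperspace X => 𝓕.val φ := by
  have h : ∀ 𝓕 : CompactInclusionHyperspace X, 𝓕.val φ = 𝓕.toStoneCech.val (stoneExt φ) := by
    intro 𝓕
    rw [val_toStoneCech]
    congr 1
    ext x
    exact congrArg Subtype.val (stoneCechExtend_stoneCechUnit φ.continuous x).symm
  simp_rw [h]
  exact (continuous_apply (stoneExt φ)).comp
    (InclusionHyperspace.isInducing_val.continuous.comp isInducing_toStoneCech.continuous)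

theorem continuous_of_val {Z : Type*} [TopologicalSpace Z] {g : Z → CompactInclusionHyperspace X}
    (h : ∀ φ : C(X, unitInterval), Continuous fun z => (g z).val φ) : Continuous g := by
  rw [isInducing_toStoneCech.continuous_iff, InclusionHyperspace.isInducing_val.continuous_iff]
  refine continuous_pi fun ψ => ?_
  simp only [Function.comp_def, val_toStoneCech]
  exact h _

/-- A criterion for the equality of two elements of the unit interval. -/
theorem _root_.TychMonad.eq_of_forall_pos_le_iff {a b : unitInterval}
    (h : ∀ α > 0, α ≤ a ↔ α ≤ b) : a = b := by
  apply le_antisymm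
  · rcases (unitInterval.nonneg' : 0 ≤ a).eq_or_lt with h0 | h0
    · rw [← h0]; exact unitInterval.nonneg'
    · exact (h a h0).1 le_rfl
  · rcases (unitInterval.nonneg' : 0 ≤ b).eq_or_lt with h0 | h0
    · rw [← h0]; exact unitInterval.nonneg'
    · exact (h b h0).2 le_rfl

/-- For each closed set `F ⊆ X`, the set `{𝓗 | F ∈ 𝓗}` is closed in `ǦX`. -/
theorem isClosed_mem [T35Space X] (F : Closeds X) :
    IsClosed {𝓗 : CompactInclusionHyperspace X | F ∈ 𝓗} := by
  rw [← isOpen_compl_iff]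
  convert (InclusionHyperspace.isOpen_minus
    (Closeds.closure (stoneCechUnit '' (F : Set X))).isClosed.isOpen_compl).preimage
      isInducing_toStoneCech.continuous using 1
  ext 𝓗
  constructor
  · intro h G hG
    by_contra hcon
    refine h (𝓗.mem_mono (A := G.1.preimage continuous_stoneCechUnit) hG ?_)
    rw [← preimage_closure_image F]
    intro x hx
    by_contra hxF
    exact hcon ⟨_, hx, hxF⟩
  · intro h hF
    rw [mem_ofPred_eq, ← preimage_closure_image F] at hF
    obtain ⟨x, hx⟩ := hF.1
    obtain ⟨y, hy, hy'⟩ := h ⟨_, ⟨_, hx⟩⟩ hF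
    exact hy' hy

/-- The closed set `{𝓗 | F ∈ 𝓗}` in `ǦX`. -/
def containing [T35Space X] (F : Closeds X) : Closeds (CompactInclusionHyperspace X) :=
  ⟨{𝓗 | F ∈ 𝓗}, isClosed_mem F⟩

/-- The map `Ǧf`, `Ǧf(𝓕) = {B | B ⊇ f(A) for some A ∈ 𝓕}`. -/
def map (f : C(X, Y)) (𝓕 : CompactInclusionHyperspace X) : CompactInclusionHyperspace Y where
  sets := {B | ∃ A ∈ 𝓕.sets, f '' (A.1 : Set X) ⊆ B.1}
  sets_nonempty := by
    obtain ⟨A, hA⟩ := 𝓕.sets_nonempty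
    obtain ⟨x, hx⟩ := A.2
    exact ⟨⟨⊤, f x, mem_univ _⟩, A, hA, subset_univ _⟩
  upward := fun B C h ⟨A, hA, hAB⟩ => ⟨A, hA, hAB.trans h⟩
  compact := by
    refine isCompact_of_sInf _ (fun B C h ⟨A, hA, hAB⟩ => ⟨A, hA, hAB.trans h⟩) ?_
    intro D hne hdir hD
    have h : sInf ((fun B : Closeds Y => B.preimage f.continuous) '' D) ∈ 𝓕 := by
      refine 𝓕.sInf_mem _ (hne.image _) ?_ ?_
      · rintro _ ⟨A, hA, rfl⟩ _ ⟨B, hB, rfl⟩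
        obtain ⟨C, hC, hCA, hCB⟩ := hdir A hA B hB
        exact ⟨_, ⟨C, hC, rfl⟩, fun x hx => hCA hx, fun x hx => hCB hx⟩
      · rintro _ ⟨B, hB, rfl⟩
        obtain ⟨hn, A, hA, hAB⟩ := hD B hB
        exact 𝓕.mem_mono ((𝓕.mem_iff A).2 hA) fun x hx => hAB ⟨x, hx, rfl⟩
    have hsub : f '' (sInf ((fun B : Closeds Y => B.preimage f.continuous) '' D) : Closeds X) ⊆
        (sInf D : Closeds Y) := by
      rintro _ ⟨x, hx, rfl⟩
      exact Closeds.mem_sInf.2 fun B hB => Closeds.mem_sInf.1 hx _ ⟨B, hB, rfl⟩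
    exact ⟨(h.1.image f).mono hsub, _, h.2, hsub⟩

theorem mem_map (f : C(X, Y)) (𝓕 : CompactInclusionHyperspace X) (B : Closeds Y) :
    B ∈ 𝓕.map f ↔ B.preimage f.continuous ∈ 𝓕 := by
  constructor
  · rintro ⟨hn, A, hA, hAB⟩
    exact 𝓕.mem_mono ((𝓕.mem_iff A).2 hA) fun x hx => hAB ⟨x, hx, rfl⟩
  · intro h
    obtain ⟨x, hx⟩ := h.1
    exact ⟨⟨f x, hx⟩, _, h.2, image_preimage_subset _ _⟩

theorem continuous_map (f : C(X, Y)) : Continuous (map f) := by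
  refine continuous_of_val fun φ => ?_
  convert continuous_val (φ.comp f) using 2 with 𝓕
  unfold val
  congr 1
  ext α
  exact mem_map f 𝓕 _

/-- The unit `x ↦ {F | x ∈ F}`. -/
def unit (x : X) : CompactInclusionHyperspace X where
  sets := {F | x ∈ F.1}
  sets_nonempty := ⟨⟨⊤, x, mem_univ x⟩, mem_univ x⟩
  upward := fun _ _ h hA => h hA
  compact := isCompact_of_sInf _ (fun _ _ h hA => h hA) fun D _ _ hD =>
    have h : x ∈ sInf D := Closeds.mem_sInf.2 fun A hA => (hD A hA).2
    ⟨⟨x, h⟩, h⟩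

theorem mem_unit (x : X) (F : Closeds X) : F ∈ unit x ↔ x ∈ F :=
  ⟨fun h => h.2, fun h => ⟨⟨x, h⟩, h⟩⟩

theorem continuous_unit : Continuous (unit : X → CompactInclusionHyperspace X) := by
  refine continuous_of_val fun φ => ?_
  convert φ.continuous using 2 with x
  refine eq_of_forall_pos_le_iff fun α hα => ?_
  rw [le_val_iff _ _ hα, mem_unit]
  rfl

theorem exists_mem_sets_iff [T35Space X] (Φ : CompactInclusionHyperspace (CompactInclusionHyperspace X))
    (F : Closeds X) : (∃ H ∈ Φ.sets, ∀ 𝓗 ∈ H.1, F ∈ 𝓗) ↔ containing F ∈ Φ :=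
  ⟨fun ⟨H, hH, h⟩ => Φ.mem_mono ((Φ.mem_iff H).2 hH) h, fun h => ⟨_, h.2, fun _ h => h⟩⟩

/-- The multiplication `Φ ↦ {F | F ∈ ⋂ H for some H ∈ Φ}`. -/
def mult [T35Space X] (Φ : CompactInclusionHyperspace (CompactInclusionHyperspace X)) :
    CompactInclusionHyperspace X where
  sets := {F | ∃ H ∈ Φ.sets, ∀ 𝓗 ∈ H.1, F ∈ 𝓗.sets}
  sets_nonempty := by
    obtain ⟨H, hH⟩ := Φ.sets_nonempty
    obtain ⟨𝓗, h𝓗⟩ := H.2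
    exact ⟨⟨⊤, 𝓗.top_mem.1⟩, H, hH, fun 𝓗' _ => 𝓗'.top_mem.2⟩
  upward := fun A B h ⟨H, hH, hA⟩ => ⟨H, hH, fun 𝓗 h𝓗 => 𝓗.upward A B h (hA 𝓗 h𝓗)⟩
  compact := by
    refine isCompact_of_sInf _
      (fun A B h ⟨H, hH, hA⟩ => ⟨H, hH, fun 𝓗 h𝓗 => 𝓗.upward A B h (hA 𝓗 h𝓗)⟩) ?_
    intro D hne hdir hD
    have h : sInf (containing '' D) ∈ Φ := by
      refine Φ.sInf_mem _ (hne.image _) ?_ ?_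
      · rintro _ ⟨A, hA, rfl⟩ _ ⟨B, hB, rfl⟩
        obtain ⟨C, hC, hCA, hCB⟩ := hdir A hA B hB
        exact ⟨_, ⟨C, hC, rfl⟩, fun 𝓗 h => 𝓗.mem_mono h hCA, fun 𝓗 h => 𝓗.mem_mono h hCB⟩
      · rintro _ ⟨A, hA, rfl⟩
        obtain ⟨hn, H, hH, hA'⟩ := hD A hA
        exact (exists_mem_sets_iff Φ A).1 ⟨H, hH, fun 𝓗 h => ⟨hn, hA' 𝓗 h⟩⟩
    have h' : ∀ 𝓗 ∈ sInf (containing '' D), sInf D ∈ 𝓗 := fun 𝓗 h𝓗 =>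
      𝓗.sInf_mem D hne hdir fun A hA => Closeds.mem_sInf.1 h𝓗 _ ⟨A, hA, rfl⟩
    obtain ⟨𝓗, h𝓗⟩ := h.1
    exact ⟨(h' 𝓗 h𝓗).1, _, h.2, fun 𝓖 h𝓖 => (h' 𝓖 h𝓖).2⟩

theorem mem_mult [T35Space X] (Φ : CompactInclusionHyperspace (CompactInclusionHyperspace X))
    (F : Closeds X) : F ∈ mult Φ ↔ containing F ∈ Φ := by
  rw [← exists_mem_sets_iff]
  constructor
  · rintro ⟨hn, H, hH, h⟩
    exact ⟨H, hH, fun 𝓗 h𝓗 => ⟨hn, h 𝓗 h𝓗⟩⟩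
  · rintro ⟨H, hH, h⟩
    obtain ⟨𝓗, h𝓗⟩ := H.2
    exact ⟨(h 𝓗 h𝓗).1, H, hH, fun 𝓖 h𝓖 => (h 𝓖 h𝓖).2⟩

theorem continuous_mult [T35Space X] :
    Continuous (mult : CompactInclusionHyperspace (CompactInclusionHyperspace X) → _) := by
  refine continuous_of_val fun φ => ?_
  convert continuous_val
    (⟨_, continuous_val φ⟩ : C(CompactInclusionHyperspace X, unitInterval)) using 2 with Φ
  refine eq_of_forall_pos_le_iff fun α hα => ?_
  rw [le_val_iff _ _ hα, le_val_iff _ _ hα, mem_mult]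
  have : containing (superlevel φ α) =
      superlevel (⟨_, continuous_val φ⟩ : C(CompactInclusionHyperspace X, unitInterval)) α := by
    ext 𝓗
    exact (le_val_iff 𝓗 φ hα).symm
  rw [this]

end CompactInclusionHyperspace

/-! ### Capacities -/

/-- Capacities on a compactum `K`. -/
structure Capacity (K : Type u) [TopologicalSpace K] where
  toFun : Closeds K → unitInterval
  map_bot : toFun ⊥ = 0
  map_top : toFun ⊤ = 1
  mono : ∀ F G : Closeds K, F ≤ G → toFun F ≤ toFun G
  usc : ∀ (F : Closeds K) (a : ℝ), (toFun F : ℝ) < a →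
    ∃ U : Set K, IsOpen U ∧ (F : Set K) ⊆ U ∧
      ∀ G : Closeds K, (G : Set K) ⊆ U → (toFun G : ℝ) < a

instance (K : Type u) [TopologicalSpace K] :
    CoeFun (Capacity K) (fun _ => Closeds K → unitInterval) :=
  ⟨Capacity.toFun⟩

/-- The topology on the set `MK` of capacities on a compactum `K`, with the subbase of all sets
`O₋(F, a)`, `F` closed in `K`, and `O₊(U, a)`, `U` open in `K`. -/
instance (K : Type u) [TopologicalSpace K] : TopologicalSpace (Capacity K) :=
  generateFrom
    ({S | ∃ (F : Closeds K) (a : ℝ), S = {c : Capacity K | (c F : ℝ) < a}} ∪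
      {S | ∃ (U : Set K) (a : ℝ), IsOpen U ∧
        S = {c : Capacity K | ∃ F : Closeds K, (F : Set K) ⊆ U ∧ a < (c F : ℝ)}})

/-- `τ`-smooth capacities on a Tychonoff space `X`: the elements of `M̌X`. -/
structure TauCapacity (X : Type u) [TopologicalSpace X] where
  toFun : Closeds X → unitInterval
  map_bot : toFun ⊥ = 0
  map_top : toFun ⊤ = 1
  mono : ∀ F G : Closeds X, F ≤ G → toFun F ≤ toFun G
  tau : ∀ (ι : Type u) [Preorder ι] [IsDirectedOrder ι] [Nonempty ι] (F : ι → Closeds X)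
    (G : Closeds X), Antitone F → (⋂ i, (F i : Set X)) ⊆ (G : Set X) → ⨅ i, toFun (F i) ≤ toFun G

instance (X : Type u) [TopologicalSpace X] :
    CoeFun (TauCapacity X) (fun _ => Closeds X → unitInterval) :=
  ⟨TauCapacity.toFun⟩

namespace Capacity

variable {K : Type u} [TopologicalSpace K]

/-- The Sugeno integral. -/
def sugeno (c : Capacity K) (φ : C(K, unitInterval)) : unitInterval :=
  ⨆ α : unitInterval, α ⊓ c (superlevel φ α)

theorem lt_sugeno_iff (c : Capacity K) (φ : C(K, unitInterval)) (a : unitInterval) :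
    a < c.sugeno φ ↔ ∃ α, a < α ∧ a < c (superlevel φ α) := by
  simp only [sugeno, lt_iSup_iff, lt_inf_iff]

theorem isOpen_minus (F : Closeds K) (a : unitInterval) : IsOpen {c : Capacity K | c F < a} :=
  isOpen_generateFrom_of_mem (.inl ⟨F, a, rfl⟩)

theorem isOpen_plus {U : Set K} (hU : IsOpen U) (a : unitInterval) :
    IsOpen {c : Capacity K | ∃ F : Closeds K, (F : Set K) ⊆ U ∧ a < c F} :=
  isOpen_generateFrom_of_mem (.inr ⟨U, a, hU, rfl⟩)

/-- On a compactum, the topology of `MK` is the weak topology of the Sugeno integrals. -/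
theorem isInducing_sugeno [CompactSpace K] [T2Space K] :
    IsInducing (fun (c : Capacity K) (φ : C(K, unitInterval)) => c.sugeno φ) := by
  have hcont : Continuous
      (fun (c : Capacity K) (φ : C(K, unitInterval)) => c.sugeno φ) := by
    refine continuous_pi fun φ => ?_
    rw [OrderTopology.continuous_iff]
    intro a
    constructor
    · convert isOpen_plus
        (isOpen_lt continuous_const φ.continuous : IsOpen {x | a < φ x}) a using 1
      ext c
      simp only [mem_preimage, mem_Ioi, lt_sugeno_iff, mem_ofPred_eq]
      constructor
      · rintro ⟨α, hα, h⟩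
        exact ⟨_, fun x hx => lt_of_lt_of_le hα hx, h⟩
      · rintro ⟨F, hFa, hF⟩
        have hn : (F : Set K).Nonempty := by
          by_contra hn
          have : F = ⊥ := SetLike.coe_injective (not_nonempty_iff_eq_empty.1 hn)
          rw [this, c.map_bot] at hF
          exact not_lt.2 unitInterval.nonneg' hF
        obtain ⟨x, hx, hmin⟩ := F.isClosed.isCompact.exists_isMinOn hn φ.continuous.continuousOn
        exact ⟨φ x, hFa hx, hF.trans_le (c.mono _ _ fun y hy => hmin hy)⟩
    · convert isOpen_minus (superlevel φ a) a using 1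
      ext c
      simp only [mem_preimage, mem_Iio, mem_ofPred_eq]
      constructor
      · intro h
        by_contra hcon
        exact absurd h (not_lt.2 ((le_inf le_rfl (not_lt.1 hcon)).trans
          (le_iSup (fun α => α ⊓ c (superlevel φ α)) a)))
      · intro h
        obtain ⟨d, hd, hda⟩ := exists_between h
        obtain ⟨V, hV, hVa, hVF⟩ := c.usc (superlevel φ a) d hd
        have hnb : ∃ b < a, ∀ x, b ≤ φ x → x ∈ V := by
          rcases (Vᶜ : Set K).eq_empty_or_nonempty with hem | hne
          · refine ⟨d, hda, fun x _ => ?_⟩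
            rw [compl_empty_iff.1 hem]
            exact mem_univ x
          · obtain ⟨x, hx, hmax⟩ :=
              hV.isClosed_compl.isCompact.exists_isMaxOn hne φ.continuous.continuousOn
            have hxa : φ x < a := by
              by_contra hxa
              exact hx (hVa (not_lt.1 hxa))
            obtain ⟨b, hb, hba⟩ := exists_between hxa
            refine ⟨b, hba, fun y hy => ?_⟩
            by_contra hyV
            exact absurd (hmax hyV) (not_le.2 (hb.trans_le hy))
        obtain ⟨b, hba, hb⟩ := hnb
        refine lt_of_le_of_lt (iSup_le fun α => ?_) (max_lt hba hda)
        rcases le_or_gt α b with hαb | hαb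
        · exact inf_le_left.trans (hαb.trans le_sup_left)
        · have : c (superlevel φ α) < d := hVF _ fun x hx => hb x (hαb.le.trans hx)
          exact inf_le_right.trans (this.le.trans le_sup_right)
  refine ⟨le_antisymm hcont.le_induced (le_generateFrom ?_)⟩
  rintro _ (⟨F, a, rfl⟩ | ⟨U, a, hU, rfl⟩)
  · rw [@isOpen_iff_forall_mem_open]
    intro c hc
    rcases lt_or_ge 1 a with ha | ha
    · exact ⟨univ, fun c _ => lt_of_le_of_lt (c F).2.2 ha, @isOpen_univ _ (_), mem_univ c⟩
    lift a to unitInterval using ⟨(c F).2.1.trans (le_of_lt hc), ha⟩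
    have hc' : c F < a := hc
    obtain ⟨b, hb, hba⟩ := exists_between hc'
    obtain ⟨U, hU, hFU, hUb⟩ := c.usc F b hb
    obtain ⟨φ, hφ1, hφ0⟩ := exists_urysohn F.isClosed hU hFU
    refine ⟨_, ?_, @IsOpen.preimage _ _ (_) _ _ continuous_induced_dom _
      ((continuous_apply φ).isOpen_preimage _ (isOpen_Iio (a := a))), ?_⟩
    · intro d hd
      have hd' : d.sugeno φ < a := hd
      refine lt_of_le_of_lt ?_ hd'
      have hle : d F ≤ 1 ⊓ d (superlevel φ 1) :=
        le_inf unitInterval.le_one' (d.mono _ _ fun x hx => (hφ1 x hx).ge)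
      exact hle.trans (le_iSup (fun α => α ⊓ d (superlevel φ α)) 1)
    · refine lt_of_le_of_lt (iSup_le fun α => ?_) hba
      rcases (unitInterval.nonneg' : 0 ≤ α).eq_or_lt with h0 | h0
      · rw [← h0]
        exact inf_le_left.trans unitInterval.nonneg'
      · have : c (superlevel φ α) < b := hUb _ fun x hx => hφ0 x (h0.trans_le hx)
        exact inf_le_right.trans this.le
  · rw [@isOpen_iff_forall_mem_open]
    rintro c ⟨F, hFU, hF⟩
    rcases lt_or_ge a 0 with ha | ha
    · exact ⟨univ, fun c _ => ⟨F, hFU, ha.trans_le (c F).2.1⟩, @isOpen_univ _ (_), mem_univ c⟩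
    lift a to unitInterval using ⟨ha, hF.le.trans (c F).2.2⟩
    have hF' : a < c F := hF
    obtain ⟨φ, hφ1, hφ0⟩ := exists_urysohn F.isClosed hU hFU
    refine ⟨_, ?_, @IsOpen.preimage _ _ (_) _ _ continuous_induced_dom _
      ((continuous_apply φ).isOpen_preimage _ (isOpen_Ioi (a := a))), ?_⟩
    · intro d hd
      obtain ⟨α, hα, h⟩ := (lt_sugeno_iff d φ a).1 hd
      exact ⟨_, fun x hx => hφ0 x (unitInterval.nonneg'.trans_lt (hα.trans_le hx)), h⟩
    · refine (lt_sugeno_iff c φ a).2 ⟨1, hF'.trans_le unitInterval.le_one', ?_⟩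
      exact hF'.trans_le (c.mono _ _ fun x hx => (hφ1 x hx).ge)

instance [CompactSpace K] [T2Space K] : T35Space (Capacity K) :=
  have : T0Space (Capacity K) := by
    refine ⟨fun c d h => ?_⟩
    have key : ∀ c d : Capacity K, Inseparable c d → ∀ F, c F ≤ d F := by
      intro c d h F
      by_contra hcon
      have hlt : c F < c F := (h.mem_open_iff (isOpen_minus F (c F))).2 (not_le.1 hcon)
      exact lt_irrefl _ hlt
    have hs : c.toFun = d.toFun := funext fun F => (key c d h F).antisymm (key d c h.symm F)
    cases c
    cases d
    cases hs
    rfl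
  { toT0Space := this, toCompletelyRegularSpace := isInducing_sugeno.completelyRegularSpace }

end Capacity

namespace TauCapacity

variable {X Y : Type u} [TopologicalSpace X] [TopologicalSpace Y]

theorem ext_apply {c d : TauCapacity X} (h : ∀ F : Closeds X, c F = d F) : c = d := by
  have hs : c.toFun = d.toFun := funext h
  cases c
  cases d
  cases hs
  rfl

theorem ext_le {c d : TauCapacity X} (h : ∀ (F : Closeds X), ∀ α > 0, α ≤ c F ↔ α ≤ d F) :
    c = d :=
  ext_apply fun F => eq_of_forall_pos_le_iff (h F)

theorem le_congr (c : TauCapacity X) {F G : Closeds X} (h : F = G) {α : unitInterval} :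
    α ≤ c F ↔ α ≤ c G := by
  rw [h]

/-- `τ`-smoothness for filtered sets instead of decreasing nets. -/
theorem exists_lt (c : TauCapacity X) (D : Set (Closeds X)) (hne : D.Nonempty)
    (hdir : DirectedOn (· ≥ ·) D) (G : Closeds X) (hG : sInf D ≤ G) {a : unitInterval}
    (ha : c G < a) : ∃ F ∈ D, c F < a := by
  have : Nonempty (D)ᵒᵈ := hne.to_subtype
  have : IsDirectedOrder (D)ᵒᵈ := ⟨fun A B => by
    obtain ⟨C, hC, hA, hB⟩ := hdir A.1 A.2 B.1 B.2
    exact ⟨⟨C, hC⟩, hA, hB⟩⟩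
  have h := c.tau (D)ᵒᵈ (fun A => A.1) G (fun _ _ h => h) (fun _ hx => hG (Closeds.mem_sInf.2
    fun A hA => mem_iInter.1 hx (⟨A, hA⟩ : D)))
  obtain ⟨A, hA⟩ := iInf_lt_iff.1 (h.trans_lt ha)
  exact ⟨A.1, A.2, hA⟩

/-- A capacity reaches the level `α` on `A α` if its Sugeno integral over the family does. -/
theorem le_iSup_iff (c : TauCapacity X) (A : unitInterval → Closeds X) (hA : Antitone A)
    {α : unitInterval} (hα : 0 < α) (hAα : ∀ x, (∀ b < α, x ∈ A b) → x ∈ A α) :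
    α ≤ ⨆ γ, γ ⊓ c (A γ) ↔ α ≤ c (A α) := by
  refine ⟨fun h => ?_, fun h => (le_inf le_rfl h).trans (le_iSup (fun γ => γ ⊓ c (A γ)) α)⟩
  by_contra hcon
  obtain ⟨_, ⟨b, hb, rfl⟩, hlt⟩ := c.exists_lt (A '' Iio α) ⟨_, 0, hα, rfl⟩
    (by
      rintro _ ⟨a, ha, rfl⟩ _ ⟨b, hb, rfl⟩
      exact ⟨_, ⟨a ⊔ b, (max_lt ha hb : a ⊔ b < α), rfl⟩, hA le_sup_left, hA le_sup_right⟩)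
    (A α) (fun x hx => hAα x fun b hb => Closeds.mem_sInf.1 hx _ ⟨b, hb, rfl⟩) (not_le.1 hcon)
  refine absurd h (not_le.2 (lt_of_le_of_lt (iSup_le fun γ => ?_) (max_lt hb hlt)))
  rcases le_or_gt γ b with hγ | hγ
  · exact inf_le_left.trans (hγ.trans le_sup_left)
  · exact inf_le_right.trans ((c.mono _ _ (hA hγ.le)).trans le_sup_right)

/-- The embedding `e_M X : M̌X → MβX`, `e_M X (c)(F) = c(F ∩ X)`. -/
def toStoneCech (c : TauCapacity X) : Capacity (StoneCech X) where
  toFun F := c (F.preimage continuous_stoneCechUnit)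
  map_bot := c.map_bot
  map_top := c.map_top
  mono := fun _ _ h => c.mono _ _ fun _ hx => h hx
  usc F a ha := by
    rcases lt_or_ge 1 a with h1 | h1
    · exact ⟨univ, isOpen_univ, subset_univ _, fun G _ => lt_of_le_of_lt (c _).2.2 h1⟩
    lift a to unitInterval using ⟨(c _).2.1.trans ha.le, h1⟩
    obtain ⟨_, ⟨W, hW, rfl⟩, hlt⟩ := c.exists_lt (nhdsTraces F) (nhdsTraces_nonempty F)
      (nhdsTraces_directedOn F) _ (sInf_nhdsTraces_le F) (show _ < a from ha)
    refine ⟨interior (W : Set (StoneCech X)), isOpen_interior, subset_interior_iff_mem_nhdsSet.2 hW,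
      fun G hG => ?_⟩
    refine lt_of_le_of_lt ?_ (show _ < (a : ℝ) from hlt)
    exact c.mono _ _ fun x hx => interior_subset (s := (W : Set (StoneCech X))) (hG hx)

/-- `M̌X` carries the topology which makes `e_M X` an embedding. -/
instance : TopologicalSpace (TauCapacity X) :=
  TopologicalSpace.induced toStoneCech inferInstance

theorem isInducing_toStoneCech :
    IsInducing (toStoneCech : TauCapacity X → Capacity (StoneCech X)) :=
  ⟨rfl⟩

theorem toStoneCech_closure [T35Space X] (c : TauCapacity X) (F : Closeds X) :
    c.toStoneCech (Closeds.closure (stoneCechUnit '' (F : Set X))) = c F :=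
  congrArg c.toFun (preimage_closure_image F)

theorem toStoneCech_injective [T35Space X] :
    Function.Injective (toStoneCech : TauCapacity X → Capacity (StoneCech X)) := by
  intro c d h
  refine ext_apply fun F => ?_
  rw [← toStoneCech_closure, ← toStoneCech_closure, h]

instance [T35Space X] : T35Space (TauCapacity X) :=
  IsEmbedding.t35Space ⟨isInducing_toStoneCech, toStoneCech_injective⟩

/-- The Sugeno integral. -/
def sugeno (c : TauCapacity X) (φ : C(X, unitInterval)) : unitInterval :=
  ⨆ α : unitInterval, α ⊓ c (superlevel φ α)

theorem le_sugeno_iff (c : TauCapacity X) (φ : C(X, unitInterval)) {α : unitInterval}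
    (hα : 0 < α) : α ≤ c.sugeno φ ↔ α ≤ c (superlevel φ α) :=
  c.le_iSup_iff (superlevel φ) (fun _ _ h => superlevel_anti φ h) hα
    fun x hx => mem_superlevel_of_lt φ x hx

theorem continuous_sugeno (φ : C(X, unitInterval)) :
    Continuous fun c : TauCapacity X => c.sugeno φ := by
  have h : ∀ c : TauCapacity X, c.sugeno φ = c.toStoneCech.sugeno (stoneExt φ) := by
    intro c
    unfold sugeno Capacity.sugeno
    congr 1
    ext1 α
    change α ⊓ c (superlevel φ α) = α ⊓ c ((superlevel (stoneExt φ) α).preimage _)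
    rw [superlevel_stoneExt]
  simp_rw [h]
  exact (continuous_apply (stoneExt φ)).comp
    (Capacity.isInducing_sugeno.continuous.comp isInducing_toStoneCech.continuous)

theorem continuous_of_sugeno {Z : Type*} [TopologicalSpace Z] {g : Z → TauCapacity X}
    (h : ∀ φ : C(X, unitInterval), Continuous fun z => (g z).sugeno φ) : Continuous g := by
  rw [isInducing_toStoneCech.continuous_iff, Capacity.isInducing_sugeno.continuous_iff]
  exact continuous_pi fun ψ => h (ψ.comp ⟨stoneCechUnit, continuous_stoneCechUnit⟩)

/-- The closed set `{c | c F ≥ α}` in `M̌X`. -/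
def atLeast [T35Space X] (F : Closeds X) (α : unitInterval) : Closeds (TauCapacity X) :=
  ⟨{c | α ≤ c F}, by
    rw [← isOpen_compl_iff]
    convert (Capacity.isOpen_minus (Closeds.closure (stoneCechUnit '' (F : Set X))) α).preimage
      isInducing_toStoneCech.continuous using 1
    ext c
    simp only [mem_compl_iff, mem_ofPred_eq, not_le, mem_preimage, toStoneCech_closure]⟩

/-- The map `M̌f`, `M̌f(c)(F) = c(f⁻¹(F))`. -/
def map (f : C(X, Y)) (c : TauCapacity X) : TauCapacity Y where
  toFun F := c (F.preimage f.continuous)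
  map_bot := c.map_bot
  map_top := c.map_top
  mono := fun _ _ h => c.mono _ _ fun _ hx => h hx
  tau ι _ _ _ F _ hF hG := c.tau ι (fun i => (F i).preimage f.continuous) _
    (fun _ _ h _ hx => hF h hx) fun _ hx => hG (mem_iInter.2 fun i => mem_iInter.1 hx i)

theorem continuous_map (f : C(X, Y)) : Continuous (map f) :=
  continuous_of_sugeno fun φ => continuous_sugeno (φ.comp f)

open Classical in
/-- The unit: `x` is sent to the capacity with value `1` on `F ∋ x` and `0` on other sets. -/
def unit (x : X) : TauCapacity X where
  toFun F := if x ∈ F then 1 else 0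
  map_bot := if_neg (notMem_empty x)
  map_top := if_pos (mem_univ x)
  mono F G h := by
    by_cases hF : x ∈ F
    · rw [if_pos hF, if_pos (h hF)]
    · rw [if_neg hF]
      exact unitInterval.nonneg'
  tau ι _ _ _ F G hF hG := by
    by_cases hx : x ∈ G
    · rw [if_pos hx]
      exact unitInterval.le_one'
    · have : ∃ i, x ∉ F i := by
        by_contra hcon
        push Not at hcon
        exact hx (hG (mem_iInter.2 hcon))
      obtain ⟨i, hi⟩ := this
      refine (iInf_le _ i).trans ?_
      rw [if_neg hi]
      exact unitInterval.nonneg'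

theorem le_unit_iff (x : X) (F : Closeds X) {α : unitInterval} (hα : 0 < α) :
    α ≤ unit x F ↔ x ∈ F := by
  classical
  by_cases h : x ∈ F
  · have : unit x F = 1 := if_pos h
    rw [this]
    exact iff_of_true unitInterval.le_one' h
  · have : unit x F = 0 := if_neg h
    rw [this]
    exact iff_of_false (not_le.2 hα) h

theorem continuous_unit : Continuous (unit : X → TauCapacity X) := by
  refine continuous_of_sugeno fun φ => ?_
  convert φ.continuous using 2 with x
  refine eq_of_forall_pos_le_iff fun α hα => ?_
  rw [le_sugeno_iff _ _ hα, le_unit_iff _ _ hα]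
  rfl

theorem le_iSup_atLeast_iff [T35Space X] (C : TauCapacity (TauCapacity X)) (F : Closeds X)
    {α : unitInterval} (hα : 0 < α) :
    α ≤ ⨆ γ, γ ⊓ C (atLeast F γ) ↔ α ≤ C (atLeast F α) :=
  C.le_iSup_iff (atLeast F) (fun _ _ h _ hc => h.trans hc) hα fun c hc => by
    change α ≤ c F
    refine le_of_forall_lt fun b hb => ?_
    obtain ⟨d, hbd, hd⟩ := exists_between hb
    exact hbd.trans_le (hc d hd)

/-- The multiplication, `C ↦ (F ↦ sup {α ∧ C({c | c(F) ≥ α})})`. -/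
def mult [T35Space X] (C : TauCapacity (TauCapacity X)) : TauCapacity X where
  toFun F := ⨆ α : unitInterval, α ⊓ C (atLeast F α)
  map_bot := by
    refine le_antisymm (iSup_le fun α => ?_) unitInterval.nonneg'
    rcases (unitInterval.nonneg' : 0 ≤ α).eq_or_lt with h0 | h0
    · rw [← h0]
      exact inf_le_left
    · have : atLeast (⊥ : Closeds X) α = ⊥ := by
        ext c
        refine iff_of_false (fun h => ?_) (notMem_empty c)
        exact absurd (c.map_bot ▸ h : α ≤ 0) (not_le.2 h0)
      rw [this, C.map_bot]
      exact inf_le_right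
  map_top := by
    refine le_antisymm unitInterval.le_one' ?_
    have : atLeast (⊤ : Closeds X) 1 = ⊤ := by
      ext c
      exact iff_of_true c.map_top.ge (mem_univ c)
    refine le_trans ?_ (le_iSup (fun α => α ⊓ C (atLeast ⊤ α)) 1)
    rw [this, C.map_top]
    exact (inf_idem _).ge
  mono F G h := iSup_mono fun α =>
    inf_le_inf_left α (C.mono _ _ fun c (hc : α ≤ c F) => hc.trans (c.mono _ _ h))
  tau ι _ _ _ F G hF hG := by
    set b := ⨅ i, ⨆ α : unitInterval, α ⊓ C (atLeast (F i) α) with hb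
    rcases (unitInterval.nonneg' : 0 ≤ b).eq_or_lt with h0 | h0
    · rw [← h0]
      exact unitInterval.nonneg'
    rw [le_iSup_atLeast_iff C G h0]
    refine (le_iInf fun i => ?_).trans (C.tau ι (fun i => atLeast (F i) b) (atLeast G b) ?_ ?_)
    · rw [← le_iSup_atLeast_iff C (F i) h0, hb]
      exact iInf_le _ i
    · intro i j h c hc
      exact le_trans (show b ≤ c (F j) from hc) (c.mono _ _ (hF h))
    · intro c hc
      exact (le_iInf fun i => mem_iInter.1 hc i).trans (c.tau ι F G hF hG)

theorem le_mult_iff [T35Space X] (C : TauCapacity (TauCapacity X)) (F : Closeds X)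
    {α : unitInterval} (hα : 0 < α) : α ≤ mult C F ↔ α ≤ C (atLeast F α) :=
  le_iSup_atLeast_iff C F hα

theorem continuous_mult [T35Space X] :
    Continuous (mult : TauCapacity (TauCapacity X) → TauCapacity X) := by
  refine continuous_of_sugeno fun φ => ?_
  convert continuous_sugeno
    (⟨_, continuous_sugeno φ⟩ : C(TauCapacity X, unitInterval)) using 2 with C
  refine eq_of_forall_pos_le_iff fun α hα => ?_
  rw [le_sugeno_iff _ _ hα, le_sugeno_iff _ _ hα, le_mult_iff _ _ hα]
  have : atLeast (superlevel φ α) α =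
      superlevel (⟨_, continuous_sugeno φ⟩ : C(TauCapacity X, unitInterval)) α := by
    ext c
    exact (le_sugeno_iff c φ hα).symm
  rw [this]

end TauCapacity

/-! ### The category of Tychonoff spaces and the monad `Ǧ` -/

/-- The category of Tychonoff spaces and continuous maps. -/
abbrev Tych : Type (u + 1) :=
  ObjectProperty.FullSubcategory (fun X : TopCat.{u} => T35Space X)

instance (X : Tych.{u}) : T35Space X.obj := X.property

/-- A Tychonoff space as an object of the category of Tychonoff spaces. -/
abbrev Tych.of (X : Type u) [TopologicalSpace X] [h : T35Space X] : Tych.{u} :=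
  ⟨TopCat.of X, h⟩

/-- A continuous map as a morphism of the category of Tychonoff spaces. -/
abbrev Tych.ofHom {X Y : Tych.{u}} (f : C(X.obj, Y.obj)) : X ⟶ Y :=
  ObjectProperty.homMk (TopCat.ofHom f)

open CompactInclusionHyperspace in
/-- The functor `Ǧ` on the category of Tychonoff spaces. -/
def checkGFunctor : Tych.{u} ⥤ Tych.{u} where
  obj X := Tych.of (CompactInclusionHyperspace X.obj)
  map f := Tych.ofHom ⟨map f.hom.hom, continuous_map _⟩
  map_id X := by
    ext 𝓕
    exact ext_mem fun A => mem_map _ _ _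
  map_comp f g := by
    ext 𝓕
    refine ext_mem fun A => ?_
    exact (mem_map _ _ _).trans ((mem_map _ _ _).trans (mem_map _ _ _)).symm

open CompactInclusionHyperspace in
/-- The monad `(Ǧ, η, μ)` on the category of Tychonoff spaces. -/
def checkG : Monad Tych.{u} where
  toFunctor := checkGFunctor
  η :=
    { app := fun X => Tych.ofHom ⟨unit, continuous_unit⟩
      naturality := fun X Y f => by
        ext x
        refine ext_mem fun A => ?_
        exact (mem_unit _ _).trans ((mem_map _ _ _).trans (mem_unit _ _)).symm }
  μ :=
    { app := fun X => Tych.ofHom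
        (X := Tych.of (CompactInclusionHyperspace (CompactInclusionHyperspace X.obj)))
        ⟨mult, continuous_mult⟩
      naturality := fun X Y f => by
        ext Φ
        refine ext_mem fun A => ?_
        refine (mem_mult _ _).trans ((mem_map _ _ _).trans ?_)
        refine Iff.trans ?_ ((mem_map _ _ _).trans (mem_mult _ _)).symm
        apply iff_of_eq
        congr 1
        ext 𝓗
        exact mem_map _ _ _ }
  assoc X := by
    ext Θ
    refine ext_mem fun A => ?_
    refine (mem_mult _ _).trans ((mem_map _ _ _).trans ?_)
    refine Iff.trans ?_ ((mem_mult _ _).trans (mem_mult _ _)).symm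
    apply iff_of_eq
    congr 1
    ext Φ
    exact mem_mult _ _
  left_unit X := by
    ext 𝓕
    refine ext_mem fun A => ?_
    exact (mem_mult _ _).trans (mem_unit _ _)
  right_unit X := by
    ext 𝓕
    refine ext_mem fun A => ?_
    refine (mem_mult _ _).trans ((mem_map _ _ _).trans ?_)
    apply iff_of_eq
    congr 1
    ext x
    exact mem_unit _ _

open TauCapacity in
/-- The functor `M̌` on the category of Tychonoff spaces. -/
def checkMFunctor : Tych.{u} ⥤ Tych.{u} where
  obj X := Tych.of (TauCapacity X.obj)
  map f := Tych.ofHom ⟨map f.hom.hom, continuous_map _⟩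
  map_id X := by
    ext c
    exact ext_apply fun A => rfl
  map_comp f g := by
    ext c
    exact ext_apply fun A => rfl

open TauCapacity in
/-- The monad `(M̌, η, μ)` on the category of Tychonoff spaces. -/
def checkM : Monad Tych.{u} where
  toFunctor := checkMFunctor
  η :=
    { app := fun X => Tych.ofHom ⟨unit, continuous_unit⟩
      naturality := fun X Y f => by
        ext x
        exact ext_apply fun A => rfl }
  μ :=
    { app := fun X => Tych.ofHom
        (X := Tych.of (TauCapacity (TauCapacity X.obj))) ⟨mult, continuous_mult⟩
      naturality := fun X Y f => by
        ext C
        exact ext_apply fun A => rfl }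
  assoc X := by
    ext Θ
    refine ext_le fun A α hα => ?_
    refine (le_mult_iff (map ⟨mult, continuous_mult⟩ Θ) A hα).trans ?_
    refine Iff.trans ?_ ((le_mult_iff (mult Θ) A hα).trans (le_mult_iff Θ _ hα)).symm
    refine le_congr Θ ?_
    ext C
    exact le_mult_iff C A hα
  left_unit X := by
    ext c
    refine ext_le fun A α hα => ?_
    exact (le_mult_iff (unit c) A hα).trans (le_unit_iff _ _ hα)
  right_unit X := by
    ext c
    refine ext_le fun A α hα => ?_
    refine (le_mult_iff (map ⟨unit, continuous_unit⟩ c) A hα).trans ?_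
    refine le_congr c ?_
    ext x
    exact le_unit_iff x A hα

/-- A monad `S` is a submonad of `T` if there is a morphism of monads `S → T` all of whose
components are embeddings. -/
def IsSubmonad (S T : Monad Tych.{u}) : Prop :=
  ∃ i : MonadHom S T, ∀ X : Tych.{u}, IsEmbedding (i.app X).hom.hom

end TychMonad

end

/-!
A compact inclusion hyperspace `𝓕` is determined by its indicator function on closed sets, which
is a capacity with values in `{0, 1}`. It is `τ`-smooth because a compact inclusion hyperspace is
closed under intersections of filtered families: if the intersection of a decreasing net of closed
sets is not in `𝓕`, then some member of the net is not in `𝓕` (`toTauCapacity`).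

The map `𝓕 ↦ toTauCapacity 𝓕` is characterised by the equivalence `α ≤ toTauCapacity 𝓕 A ↔ A ∈ 𝓕`
for every level `α > 0` (`le_toTauCapacity_iff`). Since two elements of the unit interval are equal
as soon as they lie above the same positive levels, this equivalence turns the compatibility with
maps, units and multiplications into the corresponding statements about membership. For the
multiplications, the set `{𝓗 | α ≤ toTauCapacity 𝓗 A}` is the set `{𝓗 | A ∈ 𝓗}`.

For the topology, `ǦX` carries the weak topology of the functionals `𝓕 ↦ max {α | {φ ≥ α} ∈ 𝓕}`
and `M̌X` that of the Sugeno integrals, where `φ` runs through the continuous maps `X → I`. The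
Sugeno integral of `φ` with respect to `toTauCapacity 𝓕` is the first functional
(`sugeno_toTauCapacity`), so the map is inducing, and it is clearly injective.
-/

namespace TychMonad

namespace CompactInclusionHyperspace

variable {X Y : Type u} [TopologicalSpace X] [TopologicalSpace Y]

theorem bot_notMem (𝓕 : CompactInclusionHyperspace X) : (⊥ : Closeds X) ∉ 𝓕 :=
  fun h => not_nonempty_empty h.1

open Classical in
/-- The indicator function of a compact inclusion hyperspace, as a `τ`-smooth capacity. -/
noncomputable def toTauCapacity (𝓕 : CompactInclusionHyperspace X) : TauCapacity X where
  toFun A := if A ∈ 𝓕 then 1 else 0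
  map_bot := if_neg 𝓕.bot_notMem
  map_top := if_pos 𝓕.top_mem
  mono F G h := by
    by_cases hF : F ∈ 𝓕
    · rw [if_pos hF, if_pos (𝓕.mem_mono hF h)]
    · rw [if_neg hF]
      exact unitInterval.nonneg'
  tau ι _ _ _ F G hF hG := by
    by_cases hGm : G ∈ 𝓕
    · rw [if_pos hGm]
      exact unitInterval.le_one'
    · obtain ⟨i, hi⟩ : ∃ i, F i ∉ 𝓕 := by
        by_contra! hcon
        refine hGm (𝓕.mem_mono (𝓕.sInf_mem (range F) (range_nonempty F) ?_ ?_) fun x hx =>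
          hG (mem_iInter.2 fun i => Closeds.mem_sInf.1 hx _ ⟨i, rfl⟩))
        · rintro _ ⟨i, rfl⟩ _ ⟨j, rfl⟩
          obtain ⟨k, hik, hjk⟩ := exists_ge_ge i j
          exact ⟨_, ⟨k, rfl⟩, hF hik, hF hjk⟩
        · rintro _ ⟨i, rfl⟩
          exact hcon i
      refine (iInf_le _ i).trans ?_
      rw [if_neg hi]
      exact unitInterval.nonneg'

theorem toTauCapacity_of_mem {𝓕 : CompactInclusionHyperspace X} {A : Closeds X} (h : A ∈ 𝓕) :
    𝓕.toTauCapacity A = 1 :=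
  if_pos h

theorem toTauCapacity_of_notMem {𝓕 : CompactInclusionHyperspace X} {A : Closeds X} (h : A ∉ 𝓕) :
    𝓕.toTauCapacity A = 0 :=
  if_neg h

theorem le_toTauCapacity_iff (𝓕 : CompactInclusionHyperspace X) (A : Closeds X)
    {α : unitInterval} (hα : 0 < α) : α ≤ 𝓕.toTauCapacity A ↔ A ∈ 𝓕 := by
  by_cases h : A ∈ 𝓕
  · rw [toTauCapacity_of_mem h]
    exact iff_of_true unitInterval.le_one' h
  · rw [toTauCapacity_of_notMem h]
    exact iff_of_false (not_le.2 hα) h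

theorem toTauCapacity_injective :
    Function.Injective (toTauCapacity : CompactInclusionHyperspace X → TauCapacity X) := by
  intro 𝓕 𝓖 h
  refine ext_mem fun A => ?_
  rw [← le_toTauCapacity_iff 𝓕 A one_pos, ← le_toTauCapacity_iff 𝓖 A one_pos, h]

theorem sugeno_toTauCapacity (𝓕 : CompactInclusionHyperspace X) (φ : C(X, unitInterval)) :
    𝓕.toTauCapacity.sugeno φ = 𝓕.val φ := by
  refine eq_of_forall_pos_le_iff fun α hα => ?_
  rw [TauCapacity.le_sugeno_iff _ _ hα, le_toTauCapacity_iff _ _ hα, le_val_iff _ _ hα]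

theorem continuous_toTauCapacity :
    Continuous (toTauCapacity : CompactInclusionHyperspace X → TauCapacity X) :=
  TauCapacity.continuous_of_sugeno fun φ => by
    simpa only [sugeno_toTauCapacity] using continuous_val φ

/-- `ǦX` carries the weak topology of the functionals `val`. -/
theorem isInducing_val : IsInducing
    (fun (𝓕 : CompactInclusionHyperspace X) (φ : C(X, unitInterval)) => 𝓕.val φ) := by
  refine ⟨le_antisymm (continuous_pi continuous_val).le_induced ?_⟩
  rw [← continuous_id_iff_le]
  let _ : TopologicalSpace (CompactInclusionHyperspace X) := .induced
    (fun (𝓕 : CompactInclusionHyperspace X) (φ : C(X, unitInterval)) => 𝓕.val φ) inferInstance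
  exact continuous_of_val (continuous_pi_iff.1 continuous_induced_dom)

theorem isEmbedding_toTauCapacity :
    IsEmbedding (toTauCapacity : CompactInclusionHyperspace X → TauCapacity X) := by
  refine ⟨IsInducing.of_comp continuous_toTauCapacity
    (g := fun (c : TauCapacity X) (φ : C(X, unitInterval)) => c.sugeno φ)
    (continuous_pi TauCapacity.continuous_sugeno) ?_, toTauCapacity_injective⟩
  simpa only [Function.comp_def, sugeno_toTauCapacity] using isInducing_val (X := X)

theorem toTauCapacity_map (f : C(X, Y)) (𝓕 : CompactInclusionHyperspace X) :
    (𝓕.map f).toTauCapacity = 𝓕.toTauCapacity.map f := by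
  refine TauCapacity.ext_le fun A α hα => ?_
  rw [le_toTauCapacity_iff _ _ hα, mem_map]
  exact (le_toTauCapacity_iff 𝓕 _ hα).symm

theorem toTauCapacity_unit (x : X) : (unit x).toTauCapacity = TauCapacity.unit x := by
  refine TauCapacity.ext_le fun A α hα => ?_
  rw [le_toTauCapacity_iff _ _ hα, mem_unit, TauCapacity.le_unit_iff _ _ hα]

theorem toTauCapacity_mult [T35Space X]
    (Φ : CompactInclusionHyperspace (CompactInclusionHyperspace X)) :
    (mult Φ).toTauCapacity =
      TauCapacity.mult (Φ.map ⟨toTauCapacity, continuous_toTauCapacity⟩).toTauCapacity := by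
  refine TauCapacity.ext_le fun A α hα => ?_
  rw [le_toTauCapacity_iff _ _ hα, mem_mult, TauCapacity.le_mult_iff _ _ hα,
    le_toTauCapacity_iff _ _ hα, mem_map]
  have : containing A = (TauCapacity.atLeast A α).preimage continuous_toTauCapacity := by
    ext 𝓗
    exact (le_toTauCapacity_iff 𝓗 A hα).symm
  rw [this]

end CompactInclusionHyperspace

open CompactInclusionHyperspace in
/-- The morphism of monads `Ǧ → M̌` with the components `toTauCapacity`. -/
noncomputable def checkGToCheckM : MonadHom checkG.{u} checkM.{u} where
  app X := Tych.ofHom (X := Tych.of (CompactInclusionHyperspace X.obj))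
    (Y := Tych.of (TauCapacity X.obj)) ⟨toTauCapacity, continuous_toTauCapacity⟩
  naturality X Y f := by
    ext 𝓕
    exact toTauCapacity_map f.hom.hom 𝓕
  app_η X := by
    ext x
    exact toTauCapacity_unit x
  app_μ X := by
    ext Φ
    exact toTauCapacity_mult Φ

end TychMonad

theorem mainTheorem5 :
    (∃ i : CategoryTheory.MonadHom TychMonad.checkG.{u} TychMonad.checkM.{u},
      ∀ X : TychMonad.Tych.{u},
        (∀ (𝓕 : TychMonad.CompactInclusionHyperspace X.obj)
            (A : TopologicalSpace.Closeds X.obj),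
          (A ∈ 𝓕 → TychMonad.TauCapacity.toFun ((i.app X).hom.hom 𝓕) A = 1) ∧
          (A ∉ 𝓕 → TychMonad.TauCapacity.toFun ((i.app X).hom.hom 𝓕) A = 0)) ∧
        Topology.IsEmbedding
          (fun 𝓕 : TychMonad.CompactInclusionHyperspace X.obj =>
            ((i.app X).hom.hom 𝓕 : TychMonad.TauCapacity X.obj))) ∧
    TychMonad.IsSubmonad TychMonad.checkG.{u} TychMonad.checkM.{u} := by
  exact ⟨⟨TychMonad.checkGToCheckM, fun X =>
    ⟨fun 𝓕 A => ⟨TychMonad.CompactInclusionHyperspace.toTauCapacity_of_mem,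
      TychMonad.CompactInclusionHyperspace.toTauCapacity_of_notMem⟩,
      TychMonad.CompactInclusionHyperspace.isEmbedding_toTauCapacity⟩⟩,
    TychMonad.checkGToCheckM, fun X =>
      TychMonad.CompactInclusionHyperspace.isEmbedding_toTauCapacity⟩
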